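/- A hyperplane arrangement in $\mathbb{C}^m$ is a finite collection $\mathcal{A}$ of affine hyperplanes, with complement $M(\mathcal{A})=\mathbb{C}^m\setminus\bigcup_{H\in\mathcal{A}}H$. For $k\ge 1$ and $H=\{x\in\mathbb{C}^m \mid \sum_j a_jx_j=b\}$, let $H^k=\{(\mathbf{x}_1,\dots,\mathbf{x}_k)\in(\mathbb{C}^m)^k \mid \sum_j a_jx_{i,j}=b,\ 1\le i\le k\}$, let $\mathcal{A}^k=\{H^k\mid H\in\mathcal{A}\}$, and let $M(\mathcal{A}^k)=(\mathbb{C}^m)^k\setminus\bigcup_{H\in\mathcal{A}}H^k$. Let $F(\mathbb{C}^k,n)$ be the space of ordered $n$-tuples of distinct points of $\mathbb{C}^k$, and let $p^k_{n+1}:F(\mathbb{C}^k,n+1)\to F(\mathbb{C}^k,n)$ be the projection that forgets the last point. Let $\mathcal{A}$ be a hyperplane arrangement in $\mathbb{C}^{\ell+1}$ and $\mathcal{B}$ a hyperplane arrangement in $\mathbb{C}^\ell$. Suppose that $\mathcal{A}$ is strictly linearly fibered over $\mathcal{B}$ with respect to affine coordinates $(\mathbf{x},z)=(x_1,\dots,x_\ell,z)$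 on $\mathbb{C}^{\ell+1}$: the projection $(\mathbf{x},z)\mapsto\mathbf{x}$ maps $M(\mathcal{A})$ onto $M(\mathcal{B})$, and its restriction $p:M(\mathcal{A})\to M(\mathcal{B})$ is a (locally trivial) fiber bundle whose fiber is the complement of finitely many points in $\mathbb{C}$. Then $|\mathcal{A}|=|\mathcal{B}|+n$ for some $n\ge 0$, and there are $n$ distinct affine functions $g_1,\dots,g_n:\mathbb{C}^\ell\to\mathbb{C}$ such that $\mathcal{A}$ consists of the hyperplanes $\{(\mathbf{x},z)\mid \mathbf{x}\in H\}$, $H\in\mathcal{B}$, and the hyperplanes $\{(\mathbf{x},z)\mid z=g_j(\mathbf{x})\}$, $1\le j\le n$. Moreover, for each $k\ge 1$: 1. the coordinate projection $\mathbb{C}^{k(\ell+1)}\to\mathbb{C}^{k\ell}$, $\bigl((\mathbf{x}_1,z_1),\dots,(\mathbf{x}_k,z_k)\bigr)\mapsto(\mathbf{x}_1,\dots,\mathbf{x}_k)$, restricts to a fiber bundle projection $p^k:M(\mathcal{A}^k)\to M(\mathcal{B}^k)$, with fiber the complement of $n$ points in $\mathbb{C}^k$; 2. for every such choice of $g_1,\dots,g_n$,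 the map $$g^k(\mathbf{x}_1,\dots,\mathbf{x}_k)=\Bigl(\bigl(g_1(\mathbf{x}_1),\dots,g_1(\mathbf{x}_k)\bigr),\dots,\bigl(g_n(\mathbf{x}_1),\dots,g_n(\mathbf{x}_k)\bigr)\Bigr)$$ takes $M(\mathcal{B}^k)$ into $F(\mathbb{C}^k,n)$, and the bundle $p^k$ is equivalent, by a homeomorphism of total spaces over the identity of $M(\mathcal{B}^k)$, to the pullback of $p^k_{n+1}:F(\mathbb{C}^k,n+1)\to F(\mathbb{C}^k,n)$ along $g^k:M(\mathcal{B}^k)\to F(\mathbb{C}^k,n)$; 3. $p^k$ admits a cross-section, that is, a continuous map $s:M(\mathcal{B}^k)\to M(\mathcal{A}^k)$ with $p^k\circ s=\mathrm{id}$. -/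

import Mathlib

open Set Function

/-- A subset of `ℂ^ℓ` is an affine hyperplane if it is the solution set of one
nontrivial affine equation `∑ a_j x_j = b`. -/
def IsAffineHyperplane {ℓ : ℕ} (H : Set (Fin ℓ → ℂ)) : Prop :=
  ∃ (a : Fin ℓ → ℂ) (b : ℂ), a ≠ 0 ∧ H = {x | ∑ j, a j * x j = b}

/-- A hyperplane arrangement in `ℂ^ℓ`: a finite (possibly empty) collection of affine
hyperplanes. -/
structure HyperplaneArrangement (ℓ : ℕ) where
  hyperplanes : Set (Set (Fin ℓ → ℂ))
  finite : hyperplanes.Finite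
  isAffineHyperplane : ∀ H ∈ hyperplanes, IsAffineHyperplane H

/-- The complement of a collection of subsets of a space. -/
def arrangementComplement {X : Type*} (C : Set (Set X)) : Set X := (⋃₀ C)ᶜ

/-- The subspace `H^k` of `ℂ^{kℓ} = (ℂ^ℓ)^k`: if `H` is given by `∑ a_j x_j = b`, then `H^k` is
given by the `k` equations `∑ a_j x_{i,j} = b`, that is, by `x_i ∈ H` for `1 ≤ i ≤ k`. -/
def subspacePow {ℓ : ℕ} (k : ℕ) (H : Set (Fin ℓ → ℂ)) : Set (Fin k → Fin ℓ → ℂ) :=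
  {x | ∀ i, x i ∈ H}

namespace HyperplaneArrangement

/-- The complement `M(A)` of a hyperplane arrangement. -/
def M {ℓ : ℕ} (A : HyperplaneArrangement ℓ) : Set (Fin ℓ → ℂ) :=
  arrangementComplement A.hyperplanes

/-- The redundant subspace arrangement `A^k = {H^k | H ∈ A}` in `(ℂ^ℓ)^k`. -/
def pow {ℓ : ℕ} (A : HyperplaneArrangement ℓ) (k : ℕ) : Set (Set (Fin k → Fin ℓ → ℂ)) :=
  subspacePow k '' A.hyperplanes

/-- The complement `M(A^k)` of the redundant subspace arrangement. -/
def MPow {ℓ : ℕ} (A : HyperplaneArrangement ℓ) (k : ℕ) : Set (Fin k → Fin ℓ → ℂ) :=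
  arrangementComplement (A.pow k)

end HyperplaneArrangement

/-- `p : E → B` is a fiber bundle projection with fiber `F`: every point of the base has a
neighbourhood over which `p` is trivial with fiber `F`. -/
def IsFiberBundleWithFiber (F : Type*) [TopologicalSpace F] {E B : Type*} [TopologicalSpace E]
    [TopologicalSpace B] (p : E → B) : Prop :=
  ∀ b : B, ∃ e : Bundle.Trivialization F p, b ∈ e.baseSet

/-- Affine coordinates `(x, z) = (x_1, …, x_ℓ, z)` on `ℂ^{ℓ+1}`. -/
abbrev FiberCoordinates (ℓ : ℕ) : Type :=
  (Fin (ℓ + 1) → ℂ) ≃ᵃ[ℂ] (Fin ℓ → ℂ) × ℂ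

/-- The coordinate projection `ℂ^{ℓ+1} → ℂ^ℓ`, `(x, z) ↦ x`. -/
noncomputable def coordProj {ℓ : ℕ} (c : FiberCoordinates ℓ) (y : Fin (ℓ + 1) → ℂ) : Fin ℓ → ℂ := (c y).1

/-- The coordinate projection `ℂ^{k(ℓ+1)} → ℂ^{kℓ}`, which is `(x, z) ↦ x` in each of the `k`
factors `ℂ^{ℓ+1}`. -/
noncomputable def coordProjPow {ℓ : ℕ} (c : FiberCoordinates ℓ) (k : ℕ) (y : Fin k → Fin (ℓ + 1) → ℂ) :
    Fin k → Fin ℓ → ℂ :=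
  fun i => coordProj c (y i)

/-- `A` is strictly linearly fibered over `B` with respect to the coordinates `(x, z)`: the
projection `(x, z) ↦ x` restricts to a fiber bundle projection from `M(A)` onto `M(B)`, with fiber
the complement of finitely many points in `ℂ`. -/
def IsStrictlyLinearlyFibered {ℓ : ℕ} (c : FiberCoordinates ℓ)
    (A : HyperplaneArrangement (ℓ + 1)) (B : HyperplaneArrangement ℓ) : Prop :=
  coordProj c '' A.M = B.M ∧
    ∃ (hp : MapsTo (coordProj c) A.M B.M) (S : Set ℂ), S.Finite ∧
      IsFiberBundleWithFiber (↥Sᶜ) (hp.restrict (coordProj c) A.M B.M)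

/-- `g = (g_1, …, g_n)` is a root map for `A` over `B`: the `g_j` are distinct affine functions on
`ℂ^ℓ` and `A` consists of the hyperplanes `f(x) = 0`, for `f = 0` a hyperplane of `B`, together with
the hyperplanes `z = g_j(x)`. In terms of defining polynomials, this is
`Q(A)(x, z) = Q(B)(x) · ∏ j, (z - g_j(x))`. -/
structure IsRootMap {ℓ n : ℕ} (c : FiberCoordinates ℓ) (A : HyperplaneArrangement (ℓ + 1))
    (B : HyperplaneArrangement ℓ) (g : Fin n → ((Fin ℓ → ℂ) →ᵃ[ℂ] ℂ)) : Prop where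
  injective : Injective g
  hyperplanes_eq : A.hyperplanes =
    (fun H => coordProj c ⁻¹' H) '' B.hyperplanes ∪
      range fun j => {y | (c y).2 = g j (c y).1}

/-- The map `g^k : (ℂ^ℓ)^k → (ℂ^k)^n`, whose `j`-th component is
`(g_j(x_1), …, g_j(x_k)) ∈ ℂ^k`. -/
noncomputable def rootMapPow {ℓ n : ℕ} (g : Fin n → ((Fin ℓ → ℂ) →ᵃ[ℂ] ℂ)) (k : ℕ)
    (x : Fin k → Fin ℓ → ℂ) : Fin n → Fin k → ℂ :=
  fun j i => g j (x i)

/-- The configuration space `F(ℂ^k, n)` of ordered `n`-tuples of distinct points in `ℂ^k`. -/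
def configurationSpace (k n : ℕ) : Set (Fin n → Fin k → ℂ) := {y | Injective y}

/-- The projection `F(ℂ^k, n+1) → F(ℂ^k, n)` that forgets the last point. -/
def configurationProj (k n : ℕ) (y : configurationSpace k (n + 1)) : configurationSpace k n :=
  ⟨fun j => y.1 j.castSucc, y.2.comp (Fin.castSucc_injective n)⟩

/-- Equivalence of `p : E → B` and `p' : E' → B` as bundles over `B`: a homeomorphism of total
spaces covering the identity of `B`. -/
def BundleEquivalent {E E' B : Type*} [TopologicalSpace E] [TopologicalSpace E']
    (p : E → B) (p' : E' → B) : Prop :=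
  ∃ h : E ≃ₜ E', ∀ e, p' (h e) = p e

/-! A nonempty complex affine subspace is not covered by finitely many zero sets of affine
functionals unless one contains it. Hence a hyperplane that misses the complement of an arrangement
belongs to it (`mem_of_disjoint`). Since `M(A)` maps onto `M(B)`, this puts the cylinders over `B`
in `A` and makes every other hyperplane of `A` a graph `z = g_j(x)` (`exists_isRootMap`).

Local triviality of `p` serves to show that the roots `g_j(x)` stay distinct over `M(B)`: all fibers
are homeomorphic to one punctured plane, the number of punctures is a topological invariant (counted
by ends), and at a generic point there are `n` distinct roots (`injective_apply`). So the zero set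
of `g_i - g_j`, if nonempty, misses `M(B)` and is a hyperplane of `B`; this keeps the `n` values of
`g^k` distinct on `M(B^k)` (`injective_rootMapPow`).

Now `M(A^k)` and the pullback of the configuration bundle are both the space of pairs `(x, z)` with
`z` different from the values of `g^k` at `x`. It is locally trivial because two families of shears
carry nearby configurations to a fixed one (`exists_homeomorph_move_points`), and it has a section
because a point of large norm avoids all the values. -/

/-! ### Covering affine subspaces by hyperplanes. -/

section AffineCovering

variable {V : Type*} [AddCommGroup V] [Module ℂ V]

/-- Along a line, an affine functional is an affine function of the parameter. -/
theorem AffineMap.apply_lineMap_eq (f : V →ᵃ[ℂ] ℂ) (x y : V) (t : ℂ) :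
    f (AffineMap.lineMap x y t) = f x + t * (f y - f x) := by
  rw [AffineMap.apply_lineMap, AffineMap.lineMap_apply]
  simp only [vsub_eq_sub, smul_eq_mul, vadd_eq_add]
  ring

/-- A nonempty affine subspace is not covered by the zero sets of finitely many
affine functionals unless one of them vanishes identically on it. -/
theorem exists_forall_affineMap_ne_zero (s : AffineSubspace ℂ V) (hs : (s : Set V).Nonempty)
    (F : Finset (V →ᵃ[ℂ] ℂ)) (hF : ∀ f ∈ F, ∃ x ∈ s, f x ≠ 0) :
    ∃ x ∈ s, ∀ f ∈ F, f x ≠ 0 := by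
  classical
  induction F using Finset.induction_on with
  | empty => exact ⟨hs.some, hs.some_mem, by simp⟩
  | insert f F _ ih =>
    obtain ⟨x, hx, hxF⟩ := ih fun f hf => hF f (Finset.mem_insert_of_mem hf)
    obtain ⟨y, hy, hyf⟩ := hF f (Finset.mem_insert_self f F)
    -- The parameter at which `h` vanishes on the line through `x` and `y`, when `h` is not constant
    -- there. Only finitely many parameters have to be avoided.
    let root : (V →ᵃ[ℂ] ℂ) → ℂ := fun h => -h x / (h y - h x)
    obtain ⟨t, ht⟩ := Infinite.exists_notMem_finset (insert 0 ((insert f F).image root))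
    have key : ∀ h ∈ insert f F, (h x ≠ 0 ∨ h y ≠ 0) → h (AffineMap.lineMap x y t) ≠ 0 := by
      intro h hh hne h0
      rw [AffineMap.apply_lineMap_eq] at h0
      rw [Finset.mem_insert, not_or] at ht
      by_cases hd : h y - h x = 0
      · rw [hd, mul_zero, add_zero] at h0
        rw [h0, sub_zero] at hd
        simp_all
      · refine ht.2 (Finset.mem_image.2 ⟨h, hh, ?_⟩)
        simp only [root]
        rw [div_eq_iff hd]
        linear_combination -h0
    refine ⟨AffineMap.lineMap x y t, AffineMap.lineMap_mem t hx hy, fun h hh => ?_⟩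
    rcases Finset.mem_insert.1 hh with rfl | hh'
    · exact key _ hh (Or.inr hyf)
    · exact key _ hh (Or.inl (hxF h hh'))

/-- The zero set of an affine functional, as an affine subspace. -/
noncomputable def AffineMap.zeroSubspace (f : V →ᵃ[ℂ] ℂ) : AffineSubspace ℂ V :=
  (AffineSubspace.mk' (0 : ℂ) ⊥).comap f

theorem AffineMap.mem_zeroSubspace {f : V →ᵃ[ℂ] ℂ} {x : V} : x ∈ f.zeroSubspace ↔ f x = 0 := by
  simp [AffineMap.zeroSubspace, AffineSubspace.mem_comap, AffineSubspace.mem_mk']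

/-- If one hyperplane is contained in another, they are equal. -/
theorem affineMap_zero_iff_of_imp {f h : V →ᵃ[ℂ] ℂ} (hf : ∃ x, f x = 0) (hh : ∃ x, h x ≠ 0)
    (himp : ∀ x, f x = 0 → h x = 0) (y : V) : f y = 0 ↔ h y = 0 := by
  refine ⟨himp y, fun hy => ?_⟩
  by_contra hfy
  obtain ⟨x₀, hx₀⟩ := hf
  obtain ⟨v, hv⟩ := hh
  -- Moving `v` in the direction `y - x₀` can cancel `f v`, since `f y ≠ 0 = f x₀`, but does not
  -- change `h`, since `h y = h x₀ = 0`.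
  have e : ∀ k : V →ᵃ[ℂ] ℂ, k (v - (f v / f y) • (y - x₀)) = k v - f v / f y * (k y - k x₀) := by
    intro k
    have h1 : v - (f v / f y) • (y - x₀) = (-(f v / f y)) • (y - x₀) +ᵥ v := by
      rw [vadd_eq_add, neg_smul]; abel
    have h2 : k.linear (y - x₀) = k y - k x₀ := k.linearMap_vsub y x₀
    rw [h1, AffineMap.map_vadd, map_smul, h2, smul_eq_mul, vadd_eq_add]
    ring
  have h3 := himp (v - (f v / f y) • (y - x₀)) (by rw [e, hx₀]; field_simp; ring)
  rw [e, hy, himp x₀ hx₀] at h3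
  exact hv (by simpa using h3)

/-- The set `H` is the zero set of an affine functional which is not identically zero. -/
def IsZeroSet (H : Set V) : Prop :=
  ∃ f : V →ᵃ[ℂ] ℂ, (∃ x, f x ≠ 0) ∧ H = {x | f x = 0}

/-- A hyperplane contained in the union of finitely many hyperplanes is one of them. -/
theorem mem_of_subset_sUnion {C : Set (Set V)} (hfin : C.Finite) (hC : ∀ K ∈ C, IsZeroSet K)
    {H : Set V} (hH : IsZeroSet H) (hne : H.Nonempty) (hsub : H ⊆ ⋃₀ C) : H ∈ C := by
  classical
  obtain ⟨f, hf, rfl⟩ := hH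
  choose! φ hφ hφeq using hC
  by_contra hnot
  obtain ⟨x, hx, hxC⟩ := exists_forall_affineMap_ne_zero f.zeroSubspace
    (hne.imp fun x hx => AffineMap.mem_zeroSubspace.2 hx) (hfin.toFinset.image φ) (by
      intro h hh
      obtain ⟨K, hK, rfl⟩ := Finset.mem_image.1 hh
      rw [Finite.mem_toFinset] at hK
      by_contra! hcon
      refine hnot ?_
      have := affineMap_zero_iff_of_imp hne (hφ K hK)
        (fun x hx => hcon x (AffineMap.mem_zeroSubspace.2 hx))
      rwa [show {x | f x = 0} = K by rw [hφeq K hK]; ext y; exact this y])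
  obtain ⟨K, hK, hxK⟩ := hsub (AffineMap.mem_zeroSubspace.1 hx)
  refine hxC (φ K) (Finset.mem_image_of_mem φ (hfin.mem_toFinset.2 hK)) ?_
  rw [hφeq K hK] at hxK
  exact hxK

end AffineCovering

/-! ### Cylinders and graphs in the total arrangement. -/

section Hyperplanes

variable {ℓ : ℕ}

theorem IsAffineHyperplane.isZeroSet {H : Set (Fin ℓ → ℂ)} (hH : IsAffineHyperplane H) :
    IsZeroSet H ∧ H.Nonempty := by
  classical
  obtain ⟨a, b, ha, rfl⟩ := hH
  obtain ⟨i, hi⟩ := Function.ne_iff.1 ha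
  let L : (Fin ℓ → ℂ) →ₗ[ℂ] ℂ := ∑ j, a j • LinearMap.proj j
  have hL : ∀ x, L x = ∑ j, a j * x j := fun x => by simp [L]
  have hs : ∀ c : ℂ, ∑ j, a j * (Pi.single i (c / a i) : Fin ℓ → ℂ) j = c := by
    intro c
    rw [Finset.sum_eq_single i]
    · rw [Pi.single_eq_same]; exact mul_div_cancel₀ _ hi
    · intro j _ hj; simp [hj]
    · simp
  refine ⟨⟨L.toAffineMap - AffineMap.const ℂ _ b, ⟨Pi.single i ((b + 1) / a i), ?_⟩, ?_⟩,
    ⟨Pi.single i (b / a i), hs b⟩⟩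
  · simp [hL, hs]
  · ext x
    simp [hL, sub_eq_zero]

namespace HyperplaneArrangement

theorem mem_M (A : HyperplaneArrangement ℓ) {x : Fin ℓ → ℂ} :
    x ∈ A.M ↔ ∀ H ∈ A.hyperplanes, x ∉ H := by
  simp [M, arrangementComplement]

theorem mem_MPow (A : HyperplaneArrangement ℓ) {k : ℕ} {x : Fin k → Fin ℓ → ℂ} :
    x ∈ A.MPow k ↔ ∀ H ∈ A.hyperplanes, ∃ i, x i ∉ H := by
  simp [MPow, arrangementComplement, pow, subspacePow]

theorem isZeroSet (A : HyperplaneArrangement ℓ) {H : Set (Fin ℓ → ℂ)} (hH : H ∈ A.hyperplanes) :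
    IsZeroSet H :=
  (A.isAffineHyperplane H hH).isZeroSet.1

/-- A hyperplane that misses the complement of an arrangement belongs to the arrangement. -/
theorem mem_of_disjoint (A : HyperplaneArrangement ℓ) {H : Set (Fin ℓ → ℂ)} (hH : IsZeroSet H)
    (hne : H.Nonempty) (hd : ∀ x ∈ H, x ∉ A.M) : H ∈ A.hyperplanes :=
  mem_of_subset_sUnion A.finite (fun _ => A.isZeroSet) hH hne
    fun x hx => not_not.1 (hd x hx)

/-- Finitely many affine functionals that are not identically zero are simultaneously nonzero at
some point of the complement of an arrangement. -/
theorem exists_mem_M_forall_ne_zero (A : HyperplaneArrangement ℓ)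
    (F : Finset ((Fin ℓ → ℂ) →ᵃ[ℂ] ℂ)) (hF : ∀ f ∈ F, ∃ x, f x ≠ 0) :
    ∃ x ∈ A.M, ∀ f ∈ F, f x ≠ 0 := by
  classical
  have h := fun H (hH : H ∈ A.hyperplanes) => A.isZeroSet hH
  choose! φ hφ hφeq using h
  obtain ⟨x, -, hx⟩ := exists_forall_affineMap_ne_zero (⊤ : AffineSubspace ℂ (Fin ℓ → ℂ))
    ⟨0, trivial⟩ (F ∪ A.finite.toFinset.image φ) (by
      intro f hf
      rcases Finset.mem_union.1 hf with hf | hf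
      · exact (hF f hf).imp fun x hx => ⟨trivial, hx⟩
      · obtain ⟨H, hH, rfl⟩ := Finset.mem_image.1 hf
        exact (hφ H (A.finite.mem_toFinset.1 hH)).imp fun x hx => ⟨trivial, hx⟩)
  refine ⟨x, (A.mem_M).2 fun H hH hxH => ?_, fun f hf => hx f (Finset.mem_union_left _ hf)⟩
  refine hx (φ H) (Finset.mem_union_right _
    (Finset.mem_image_of_mem φ (A.finite.mem_toFinset.2 hH))) ?_
  rw [hφeq H hH] at hxH
  exact hxH

end HyperplaneArrangement

variable {c : FiberCoordinates ℓ} {A : HyperplaneArrangement (ℓ + 1)} {B : HyperplaneArrangement ℓ}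

/-- The coordinate projection as an affine map. -/
noncomputable def coordProjAffine (c : FiberCoordinates ℓ) :
    (Fin (ℓ + 1) → ℂ) →ᵃ[ℂ] (Fin ℓ → ℂ) :=
  (LinearMap.fst ℂ (Fin ℓ → ℂ) ℂ).toAffineMap.comp c.toAffineMap

theorem coordProj_surjective (c : FiberCoordinates ℓ) : Surjective (coordProj c) :=
  fun x => ⟨c.symm (x, 0), by simp [coordProj]⟩

theorem IsZeroSet.preimage_coordProj {H : Set (Fin ℓ → ℂ)} (hH : IsZeroSet H) :
    IsZeroSet (coordProj c ⁻¹' H) := by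
  obtain ⟨f, ⟨x, hx⟩, rfl⟩ := hH
  obtain ⟨y, rfl⟩ := coordProj_surjective c x
  exact ⟨f.comp (coordProjAffine c), ⟨y, hx⟩, rfl⟩

/-- The preimages of the hyperplanes of the base belong to the total arrangement. -/
theorem preimage_coordProj_mem (h : coordProj c '' A.M = B.M) {H : Set (Fin ℓ → ℂ)}
    (hH : H ∈ B.hyperplanes) : coordProj c ⁻¹' H ∈ A.hyperplanes := by
  obtain ⟨h1, h2⟩ := (B.isAffineHyperplane H hH).isZeroSet
  refine A.mem_of_disjoint h1.preimage_coordProj (h2.preimage (coordProj_surjective c)) ?_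
  intro y hy hyA
  exact B.mem_M.1 (h ▸ mem_image_of_mem _ hyA) H hH hy

/-- A hyperplane of the total arrangement which is not the preimage of a hyperplane of the base is
the graph of an affine function. -/
theorem exists_graph_of_not_mem_image (h : coordProj c '' A.M = B.M) {H : Set (Fin (ℓ + 1) → ℂ)}
    (hH : H ∈ A.hyperplanes) (hnot : H ∉ (fun H => coordProj c ⁻¹' H) '' B.hyperplanes) :
    ∃ g : (Fin ℓ → ℂ) →ᵃ[ℂ] ℂ, H = {y | (c y).2 = g (c y).1} := by
  obtain ⟨⟨f, hf, rfl⟩, hne⟩ := (A.isAffineHyperplane H hH).isZeroSet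
  let φ : (Fin ℓ → ℂ) × ℂ →ᵃ[ℂ] ℂ := f.comp c.symm.toAffineMap
  let α : (Fin ℓ → ℂ) →ᵃ[ℂ] ℂ :=
    φ.comp (LinearMap.inl ℂ (Fin ℓ → ℂ) ℂ).toAffineMap
  let β : ℂ := φ.linear (0, 1)
  have hα : ∀ y, f y = α (c y).1 + (c y).2 * β := by
    intro y
    have h1 : f y = φ ((c y).2 • ((0, 1) : (Fin ℓ → ℂ) × ℂ) +ᵥ ((c y).1, (0 : ℂ))) := by
      have h2 : (c y).2 • ((0, 1) : (Fin ℓ → ℂ) × ℂ) +ᵥ ((c y).1, (0 : ℂ)) = c y := by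
        ext <;> simp
      rw [h2]
      simp [φ]
    rw [h1, AffineMap.map_vadd, map_smul, smul_eq_mul, vadd_eq_add, add_comm]
    rfl
  -- If the equation does not involve `z`, the hyperplane is a cylinder. Its base misses `M(B)`,
  -- because any lift of a base point lies in the hyperplane and so outside `M(A)`; hence the base
  -- is in `B`.
  by_cases hβ : β = 0
  · refine absurd ⟨{x | α x = 0}, ?_, ?_⟩ hnot
    · refine B.mem_of_disjoint ⟨α, ?_, rfl⟩ ?_ ?_
      · obtain ⟨y, hy⟩ := hf
        exact ⟨(c y).1, by simpa [hα, hβ] using hy⟩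
      · obtain ⟨y, hy⟩ := hne
        exact ⟨(c y).1, by simpa [hα, hβ] using hy⟩
      · intro x hx hxB
        rw [← h] at hxB
        obtain ⟨y, hy, rfl⟩ := hxB
        refine A.mem_M.1 hy _ hH ?_
        simpa [hα, hβ, coordProj] using hx
    · ext y
      simp [hα, hβ, coordProj]
  · refine ⟨(-β⁻¹) • α, ?_⟩
    ext y
    simp only [mem_ofPred_eq, hα, AffineMap.coe_smul, Pi.smul_apply, smul_eq_mul]
    constructor
    · intro h0
      field_simp
      linear_combination h0
    · intro h0
      rw [h0]
      field_simp
      ring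

/-- Surjectivity of the projection makes distinct hyperplanes of `B` have distinct cylinders, so `n`
counts the remaining hyperplanes of `A`, which are graphs. Only the image of `M(A)` matters here,
not local triviality. -/
theorem exists_isRootMap (h : coordProj c '' A.M = B.M) :
    ∃ n : ℕ, A.hyperplanes.ncard = B.hyperplanes.ncard + n ∧
      ∃ g : Fin n → ((Fin ℓ → ℂ) →ᵃ[ℂ] ℂ), IsRootMap c A B g := by
  set V := (fun H => coordProj c ⁻¹' H) '' B.hyperplanes with hV
  have hVA : V ⊆ A.hyperplanes := by
    rintro _ ⟨H, hH, rfl⟩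
    exact preimage_coordProj_mem h hH
  have hN : (A.hyperplanes \ V).Finite := A.finite.sdiff
  have : Finite ↥(A.hyperplanes \ V) := hN
  let e := Finite.equivFin ↥(A.hyperplanes \ V)
  have hg := fun j => exists_graph_of_not_mem_image h (e.symm j).2.1 (e.symm j).2.2
  choose g hg using hg
  refine ⟨(A.hyperplanes \ V).ncard, ?_, g, ⟨?_, ?_⟩⟩
  · have h1 := ncard_image_of_injective B.hyperplanes
      (preimage_injective.2 (coordProj_surjective c))
    rw [← h1]
    exact ((add_comm _ _).trans (ncard_sdiff_add_ncard_of_subset hVA A.finite)).symm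
  · intro i j hij
    exact e.symm.injective (Subtype.ext (by rw [hg i, hg j, hij]))
  · ext H
    constructor
    · intro hH
      by_cases hHV : H ∈ V
      · exact Or.inl hHV
      · refine Or.inr ⟨e ⟨H, hH, hHV⟩, ?_⟩
        have := hg (e ⟨H, hH, hHV⟩)
        rw [Equiv.symm_apply_apply] at this
        exact this.symm
    · rintro (hH | ⟨j, rfl⟩)
      · exact hVA hH
      · have := (e.symm j).2.1
        rwa [hg j] at this

end Hyperplanes

/-! ### Counting the ends of a punctured plane. -/

section Ends

/-- If a space is, up to a compact set, a disjoint union of non-relatively-compact open sets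
indexed by `ι`, and the complement of every compact set contains, up to a compact set, a union of
preconnected sets indexed by `κ`, then `ι` has at most as many elements as `κ`. -/
theorem card_le_of_open_ends_of_preconnected_ends {X ι κ : Type*} [TopologicalSpace X] [Finite κ]
    (U : ι → Set X) (hUo : ∀ i, IsOpen (U i)) (hUd : Pairwise (Disjoint on U))
    (hUn : ∀ i K, IsCompact K → ¬ U i ⊆ K) (hUc : ∃ K, IsCompact K ∧ (⋃ i, U i)ᶜ ⊆ K)
    (hC : ∀ K : Set X, IsCompact K → ∃ C : κ → Set X, (∀ j, IsPreconnected (C j)) ∧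
      (∀ j, Disjoint (C j) K) ∧ ∃ K', IsCompact K' ∧ (⋃ j, C j)ᶜ ⊆ K') :
    Nat.card ι ≤ Nat.card κ := by
  obtain ⟨K, hK, hUK⟩ := hUc
  obtain ⟨C, hCp, hCK, K', hK', hCK'⟩ := hC K hK
  have hCU : ∀ j, C j ⊆ ⋃ i, U i := fun j x hx => by
    by_contra hxU
    exact (disjoint_left.1 (hCK j)) hx (hUK hxU)
  have hex : ∀ i, ∃ j, (C j ∩ U i).Nonempty := by
    intro i
    obtain ⟨x, hx, hxK'⟩ := not_subset.1 (hUn i K' hK')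
    have : x ∈ ⋃ j, C j := by
      by_contra h
      exact hxK' (hCK' h)
    obtain ⟨j, hj⟩ := mem_iUnion.1 this
    exact ⟨j, x, hj, hx⟩
  choose f hf using hex
  refine Nat.card_le_card_of_injective f fun i i' hii => ?_
  by_contra hne
  obtain ⟨x, hxC, hxU⟩ := hf i
  obtain ⟨y, hyC, hyU⟩ := hf i'
  rw [← hii] at hyC
  -- A preconnected `C` meeting two of the disjoint open sets that cover it would be separated by `U
  -- i` and the union of the others.
  obtain ⟨z, -, hz, hz'⟩ := hCp (f i) (U i) (⋃ l ≠ i, U l) (hUo i)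
    (isOpen_biUnion fun l _ => hUo l)
    (fun w hw => by
      obtain ⟨l, hl⟩ := mem_iUnion.1 (hCU _ hw)
      by_cases hli : l = i
      · exact Or.inl (hli ▸ hl)
      · exact Or.inr (mem_biUnion hli hl))
    ⟨x, hxC, hxU⟩ ⟨y, hyC, mem_biUnion (Ne.symm hne) hyU⟩
  obtain ⟨l, hl, hzl⟩ := mem_iUnion₂.1 hz'
  exact disjoint_left.1 (hUd hl) hzl hz

/-- A punctured disc is preconnected. -/
theorem isPreconnected_ball_sdiff_singleton (p : ℂ) {r : ℝ} (hr : 0 < r) :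
    IsPreconnected (Metric.ball p r \ {p}) := by
  -- The exponential presents the punctured disc as the image of a convex half-plane.
  have h : Metric.ball p r \ {p} = (fun w => p + Complex.exp w) '' {w | w.re < Real.log r} := by
    ext z
    constructor
    · rintro ⟨hz, hzp⟩
      have h0 : z - p ≠ 0 := sub_ne_zero.2 hzp
      refine ⟨Complex.log (z - p), ?_, by simp [Complex.exp_log h0]⟩
      rw [mem_ofPred_eq, Complex.log_re]
      exact Real.log_lt_log (norm_pos_iff.2 h0) (by simpa [dist_eq_norm] using hz)
    · rintro ⟨w, hw, rfl⟩
      refine ⟨?_, by simp⟩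
      rw [Metric.mem_ball, dist_eq_norm, add_sub_cancel_left, Complex.norm_exp]
      exact (Real.lt_log_iff_exp_lt hr).1 hw
  rw [h]
  exact (convex_halfSpace_re_lt _).isPreconnected.image _ (by fun_prop)

/-- The exterior of a disc is preconnected. -/
theorem isPreconnected_setOf_lt_norm {R : ℝ} (hR : 0 < R) : IsPreconnected {z : ℂ | R < ‖z‖} := by
  have h : {z : ℂ | R < ‖z‖} = Complex.exp '' {w | Real.log R < w.re} := by
    ext z
    constructor
    · intro hz
      have h0 : z ≠ 0 := norm_pos_iff.1 (hR.trans hz)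
      refine ⟨Complex.log z, ?_, Complex.exp_log h0⟩
      rw [mem_ofPred_eq, Complex.log_re]
      exact Real.log_lt_log hR hz
    · rintro ⟨w, hw, rfl⟩
      rw [mem_ofPred_eq, Complex.norm_exp]
      exact (Real.log_lt_iff_lt_exp hR).1 hw
  rw [h]
  exact (convex_halfSpace_re_gt _).isPreconnected.image _ (by fun_prop)

/-- The neighbourhoods of the ends of `ℂ \ P`: punctured discs of radius `r` around the points of
`P`, and the exterior of the disc of radius `R`. -/
def endNhd (P : Set ℂ) (r R : ℝ) : Option P → Set ↥Pᶜ
  | none => {z | R < ‖(z : ℂ)‖}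
  | some p => {z | dist (z : ℂ) p < r}

/-- The radii `r` and `R` separate the ends of `ℂ \ P`. -/
structure IsEndRadii (P : Set ℂ) (r R : ℝ) : Prop where
  r_pos : 0 < r
  R_pos : 0 < R
  two_mul_le : ∀ p ∈ P, ∀ q ∈ P, p ≠ q → 2 * r ≤ dist p q
  norm_add_le : ∀ p ∈ P, ‖p‖ + r ≤ R

variable {P : Set ℂ} {r R : ℝ}

theorem isOpen_endNhd (i : Option P) : IsOpen (endNhd P r R i) := by
  cases i with
  | none => exact isOpen_lt continuous_const (by fun_prop)
  | some p => exact isOpen_lt (by fun_prop) continuous_const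

theorem IsEndRadii.pairwise_disjoint (h : IsEndRadii P r R) :
    Pairwise (Disjoint on endNhd P r R) := by
  have aux : ∀ p : P, Disjoint (endNhd P r R (some p)) (endNhd P r R none) := by
    intro p
    refine disjoint_left.2 fun z (hz : dist (z : ℂ) p < r) (hz' : R < ‖(z : ℂ)‖) => ?_
    have h1 := h.norm_add_le p p.2
    rw [dist_eq_norm] at hz
    have h2 := norm_le_norm_add_norm_sub' (z : ℂ) p
    linarith
  rintro (_ | p) (_ | q) hij
  · exact absurd rfl hij
  · exact (aux q).symm
  · exact aux p
  · refine disjoint_left.2 fun z (hz : dist (z : ℂ) p < r) (hz' : dist (z : ℂ) q < r) => ?_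
    have h1 := h.two_mul_le p p.2 q q.2 fun e => hij (congrArg some (Subtype.ext e))
    have h2 := dist_triangle_left (p : ℂ) q z
    linarith

theorem IsEndRadii.isPreconnected_endNhd (h : IsEndRadii P r R) (i : Option P) :
    IsPreconnected (endNhd P r R i) := by
  rw [← Topology.IsInducing.subtypeVal.isPreconnected_image]
  cases i with
  | none =>
    convert isPreconnected_setOf_lt_norm h.R_pos using 1
    ext z
    constructor
    · rintro ⟨w, hw, rfl⟩
      exact hw
    · intro (hz : R < ‖z‖)
      refine ⟨⟨z, fun hzP => ?_⟩, hz, rfl⟩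
      have := h.norm_add_le z hzP
      linarith [h.r_pos]
  | some p =>
    convert isPreconnected_ball_sdiff_singleton p h.r_pos using 1
    ext z
    constructor
    · rintro ⟨w, hw, rfl⟩
      exact ⟨hw, fun e => w.2 (e ▸ p.2)⟩
    · rintro ⟨hz, hzp⟩
      refine ⟨⟨z, fun hzP => ?_⟩, hz, rfl⟩
      have := h.two_mul_le z hzP p p.2 hzp
      rw [Metric.mem_ball] at hz
      linarith [h.r_pos]

/-- In `ℂ` this set is a closed disc with open discs around the punctures removed, so it is closed
and bounded. -/
theorem isCompact_compl_iUnion_endNhd (hr : 0 < r) :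
    IsCompact (⋃ i, endNhd P r R i)ᶜ := by
  rw [Subtype.isCompact_iff]
  have : Subtype.val '' (⋃ i, endNhd P r R i)ᶜ =
      Metric.closedBall 0 R ∩ ⋂ p ∈ P, {z : ℂ | r ≤ dist z p} := by
    ext z
    constructor
    · rintro ⟨w, hw, rfl⟩
      rw [mem_compl_iff, mem_iUnion, not_exists] at hw
      refine ⟨by simpa using not_lt.1 (hw none), mem_iInter₂.2 fun p hp => ?_⟩
      exact le_of_not_gt fun hlt : dist (w : ℂ) p < r => hw (some ⟨p, hp⟩) hlt
    · rintro ⟨hz, hz'⟩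
      rw [mem_iInter₂] at hz'
      refine ⟨⟨z, fun hzP => ?_⟩, ?_, rfl⟩
      · have := hz' z hzP
        rw [mem_ofPred_eq, dist_self] at this
        linarith
      · rw [mem_compl_iff, mem_iUnion, not_exists]
        rintro (_ | p)
        · exact not_lt.2 (by simpa using hz)
        · exact fun hlt : dist z (p : ℂ) < r => not_le_of_gt hlt (hz' p p.2)
  rw [this]
  exact (isCompact_closedBall _ _).inter_right
    (isClosed_biInter fun p _ => isClosed_le continuous_const (by fun_prop))

-- A compact set in the complement of `P` is bounded in `ℂ` and stays away from each puncture; as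
-- `P` is finite, all conditions hold for small `r` and large `R`. Thus end neighbourhoods can be
-- shrunk to escape any compact set.
open Filter Topology in
theorem exists_isEndRadii_disjoint (hP : P.Finite) {K : Set ↥Pᶜ} (hK : IsCompact K) :
    ∃ r R, IsEndRadii P r R ∧ ∀ i, Disjoint (endNhd P r R i) K := by
  have hK' : IsCompact (Subtype.val '' K) := hK.image continuous_subtype_val
  have e1 : ∀ᶠ r : ℝ in 𝓝[>] 0, ∀ p ∈ P, ∀ q ∈ P, p ≠ q → 2 * r ≤ dist p q := by
    refine (hP.eventually_all).2 fun p _ => (hP.eventually_all).2 fun q _ => ?_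
    by_cases hpq : p = q
    · simp [hpq]
    · have : 0 < dist p q / 2 := half_pos (dist_pos.2 hpq)
      filter_upwards [Ioo_mem_nhdsGT this] with r hr _
      linarith [hr.2]
  have e2 : ∀ᶠ r : ℝ in 𝓝[>] 0, ∀ p ∈ P, ∀ z ∈ K, r ≤ dist (z : ℂ) p := by
    refine (hP.eventually_all).2 fun p hp => ?_
    have : (Subtype.val '' K)ᶜ ∈ 𝓝 p :=
      hK'.isClosed.isOpen_compl.mem_nhds fun ⟨w, _, hw⟩ => w.2 (hw ▸ hp)
    obtain ⟨ε, hε, hball⟩ := Metric.mem_nhds_iff.1 this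
    filter_upwards [Ioo_mem_nhdsGT hε] with r hr z hz
    by_contra! hlt
    exact hball (Metric.mem_ball.2 (hlt.trans hr.2)) ⟨z, hz, rfl⟩
  obtain ⟨r, h1, h2, hr⟩ := (e1.and (e2.and self_mem_nhdsWithin)).exists
  obtain ⟨R₀, hR₀⟩ := hK'.isBounded.exists_norm_le
  have e3 : ∀ᶠ R : ℝ in atTop, ∀ p ∈ P, ‖p‖ + r ≤ R :=
    (hP.eventually_all).2 fun p _ => eventually_ge_atTop _
  obtain ⟨R, h3, h4, h5⟩ := (e3.and ((eventually_ge_atTop R₀).and (eventually_gt_atTop 0))).exists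
  refine ⟨r, R, ⟨hr, h5, h1, h3⟩, ?_⟩
  rintro (_ | p)
  · exact disjoint_left.2 fun z (hz : R < ‖(z : ℂ)‖) hzK =>
      absurd (hR₀ z ⟨z, hzK, rfl⟩) (not_le.2 (h4.trans_lt hz))
  · exact disjoint_left.2 fun z (hz : dist (z : ℂ) p < r) hzK =>
      absurd (h2 p p.2 z hzK) (not_le.2 hz)

/-- Combined with shrinking away from a compact set, this shows that no end neighbourhood is
contained in a compact set. -/
theorem IsEndRadii.inter_nonempty {r' R' : ℝ} (h : IsEndRadii P r R) (h' : IsEndRadii P r' R')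
    (i : Option P) : (endNhd P r R i ∩ endNhd P r' R' i).Nonempty := by
  cases i with
  | none =>
    have hn : ‖((max R R' + 1 : ℝ) : ℂ)‖ = max R R' + 1 := by
      rw [Complex.norm_real, Real.norm_of_nonneg]
      linarith [le_max_left R R', h.R_pos]
    refine ⟨⟨((max R R' + 1 : ℝ) : ℂ), fun hP => ?_⟩, ?_, ?_⟩
    · have := h.norm_add_le _ hP
      rw [hn] at this
      linarith [le_max_left R R', h.r_pos]
    · change R < ‖((max R R' + 1 : ℝ) : ℂ)‖
      rw [hn]
      linarith [le_max_left R R']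
    · change R' < ‖((max R R' + 1 : ℝ) : ℂ)‖
      rw [hn]
      linarith [le_max_right R R']
  | some p =>
    have hpos : 0 < min r r' := lt_min h.r_pos h'.r_pos
    have hd : dist ((p : ℂ) + ((min r r' / 2 : ℝ) : ℂ)) p = min r r' / 2 := by
      rw [dist_eq_norm, add_sub_cancel_left, Complex.norm_real, Real.norm_of_nonneg (by linarith)]
    refine ⟨⟨(p : ℂ) + ((min r r' / 2 : ℝ) : ℂ), fun hP => ?_⟩, ?_, ?_⟩
    · have := h.two_mul_le _ hP p p.2 fun e => by
        rw [e, dist_self] at hd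
        linarith
      rw [hd] at this
      linarith [min_le_left r r']
    · change dist ((p : ℂ) + ((min r r' / 2 : ℝ) : ℂ)) p < r
      rw [hd]
      linarith [min_le_left r r']
    · change dist ((p : ℂ) + ((min r r' / 2 : ℝ) : ℂ)) p < r'
      rw [hd]
      linarith [min_le_right r r']

/-- The ends on the side of `P` serve as the open sets, those of `Q` pulled back along `e` as the
preconnected ones. `Option` adds the end at infinity on both sides, which cancels. -/
theorem ncard_le_ncard_of_homeomorph_compl {P Q : Set ℂ} (hP : P.Finite) (hQ : Q.Finite)
    (e : ↥Pᶜ ≃ₜ ↥Qᶜ) : P.ncard ≤ Q.ncard := by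
  have := hP.to_subtype
  have := hQ.to_subtype
  obtain ⟨r, R, h, -⟩ := exists_isEndRadii_disjoint hP isCompact_empty
  have key : Nat.card (Option P) ≤ Nat.card (Option Q) := by
    refine card_le_of_open_ends_of_preconnected_ends (endNhd P r R) isOpen_endNhd
      h.pairwise_disjoint ?_ ⟨_, isCompact_compl_iUnion_endNhd h.r_pos, Subset.rfl⟩ ?_
    · intro i K hK hsub
      obtain ⟨r', R', h', hd⟩ := exists_isEndRadii_disjoint hP hK
      obtain ⟨z, hz, hz'⟩ := h.inter_nonempty h' i
      exact disjoint_left.1 (hd i) hz' (hsub hz)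
    · intro K hK
      obtain ⟨r', R', h', hd⟩ := exists_isEndRadii_disjoint hQ (hK.image e.continuous)
      refine ⟨fun j => e ⁻¹' endNhd Q r' R' j, fun j => ?_, fun j => ?_,
        e ⁻¹' (⋃ j, endNhd Q r' R' j)ᶜ, ?_, ?_⟩
      · exact e.isPreconnected_preimage.2 (h'.isPreconnected_endNhd j)
      · exact disjoint_left.2 fun z hz hzK =>
          disjoint_left.1 (hd j) hz (mem_image_of_mem e hzK)
      · exact e.isCompact_preimage.2 (isCompact_compl_iUnion_endNhd h'.r_pos)
      · rw [preimage_compl, preimage_iUnion]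
  rw [Finite.card_option, Finite.card_option] at key
  exact Nat.le_of_succ_le_succ key

/-- The number of punctures of a finitely punctured plane is a topological invariant. -/
theorem ncard_eq_ncard_of_homeomorph_compl {P Q : Set ℂ} (hP : P.Finite) (hQ : Q.Finite)
    (e : ↥Pᶜ ≃ₜ ↥Qᶜ) : P.ncard = Q.ncard :=
  (ncard_le_ncard_of_homeomorph_compl hP hQ e).antisymm
    (ncard_le_ncard_of_homeomorph_compl hQ hP e.symm)

end Ends

/-! ### Local triviality of families of punctured vector spaces. -/

section LocalTriviality

/-- A homeomorphism from the part of `E` over an open set `U` to `U × F`, over `U`, gives a local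
trivialization. -/
theorem exists_trivialization_of_homeomorph {F E X : Type*} [TopologicalSpace F]
    [TopologicalSpace E] [TopologicalSpace X] [Nonempty F] {p : E → X} (hp : Continuous p)
    {U : Set X} (hU : IsOpen U) {x : X} (hxU : x ∈ U) (H : p ⁻¹' U ≃ₜ U × F)
    (hH : ∀ y, (H y).1.1 = p y) : ∃ e : Bundle.Trivialization F p, x ∈ e.baseSet := by
  classical
  let e : Bundle.Trivialization F p :=
    -- The values away from `U` are arbitrary; they only make the two maps total.
    { toFun y := if hy : p y ∈ U then ⟨(H ⟨y, hy⟩).1, (H ⟨y, hy⟩).2⟩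
        else ⟨x, Classical.arbitrary F⟩
      invFun z := H.symm (if hz : z.1 ∈ U then ⟨z.1, hz⟩ else ⟨x, hxU⟩, z.2)
      source := p ⁻¹' U
      target := U ×ˢ Set.univ
      map_source' y (hy : p y ∈ U) := by simp [hy]
      map_target' _ _ := Subtype.coe_prop _
      left_inv' y (hy : p y ∈ U) := by simp [hy]
      right_inv' z := by
        rintro ⟨hz, -⟩
        simpa [hz] using fun h ↦ (h (H.symm _).2).elim
      open_source := hU.preimage hp
      open_target := hU.prod isOpen_univ
      continuousOn_toFun := continuousOn_iff_continuous_domRestrict.mpr <|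
        ((continuous_subtype_val.prodMap continuous_id).comp H.continuous).congr
        fun ⟨y, (hy : p y ∈ U)⟩ ↦ by simp [Prod.map, hy]
      continuousOn_invFun := continuousOn_iff_continuous_domRestrict.mpr <|
        ((continuous_subtype_val.comp H.symm.continuous).comp (by fun_prop :
          Continuous fun z ↦ ⟨⟨_, z.2.1⟩, z.1.2⟩)).congr
          fun ⟨⟨z, i⟩, ⟨hz, _⟩⟩ ↦ by simp [hz]
      baseSet := U
      open_baseSet := hU
      source_eq := rfl
      target_eq := rfl
      proj_toFun y (hy : p y ∈ U) := by simp [hy, hH] }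
  exact ⟨e, hxU⟩

theorem IsFiberBundleWithFiber.comp_homeomorph {F E E' X : Type*} [TopologicalSpace F]
    [TopologicalSpace E] [TopologicalSpace E'] [TopologicalSpace X] {p : E → X}
    (h : IsFiberBundleWithFiber F p) (e : E' ≃ₜ E) : IsFiberBundleWithFiber F (p ∘ e) := fun x => by
  obtain ⟨t, ht⟩ := h x
  exact ⟨t.compHomeomorph e, ht⟩

variable {n : ℕ}

/-- The value at `t` of the `j`-th Lagrange basis polynomial for the nodes `a`. -/
noncomputable def lagrangeValue (a : Fin n → ℝ) (j : Fin n) (t : ℝ) : ℝ :=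
  ∏ i ∈ Finset.univ.erase j, (t - a i) * (a j - a i)⁻¹

theorem lagrangeValue_apply {a : Fin n → ℝ} (ha : Injective a) (j l : Fin n) :
    lagrangeValue a j (a l) = if j = l then 1 else 0 := by
  split_ifs with h
  · subst h
    refine Finset.prod_eq_one fun i hi => mul_inv_cancel₀ (sub_ne_zero.2 (ha.ne ?_))
    exact (Finset.ne_of_mem_erase hi).symm
  · exact Finset.prod_eq_zero (i := l) (by simp [Ne.symm h]) (by simp)

theorem Continuous.lagrangeValue {Y : Type*} [TopologicalSpace Y] {a : Y → Fin n → ℝ}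
    (ha : Continuous a) (hinj : ∀ y, Injective (a y)) (j : Fin n) {t : Y → ℝ} (ht : Continuous t) :
    Continuous fun y => lagrangeValue (a y) j (t y) := by
  refine continuous_finsetProd _ fun i hi => Continuous.mul (by fun_prop) ?_
  refine Continuous.inv₀ (by fun_prop) fun y => sub_ne_zero.2 ((hinj y).ne ?_)
  exact (Finset.ne_of_mem_erase hi).symm

variable {V : Type*} [NormedAddCommGroup V] [NormedSpace ℝ V]

/-- The displacement at the level `t` of the shear that moves the level `a j` by `w j`. -/
noncomputable def shearValue (a : Fin n → ℝ) (w : Fin n → V) (t : ℝ) : V :=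
  ∑ j, lagrangeValue a j t • w j

theorem shearValue_apply {a : Fin n → ℝ} (ha : Injective a) (w : Fin n → V) (l : Fin n) :
    shearValue a w (a l) = w l := by
  simp [shearValue, lagrangeValue_apply ha, ite_smul]

/-- Displacements in the kernel of `L` leave the level unchanged, so a shear is inverted by
subtracting the same displacement. -/
theorem map_shearValue_eq_zero (a : Fin n → ℝ) {w : Fin n → V} {L : V →L[ℝ] ℝ}
    (hw : ∀ j, L (w j) = 0) (t : ℝ) : L (shearValue a w t) = 0 := by
  simp [shearValue, hw]

theorem continuous_shearValue {Y : Type*} [TopologicalSpace Y] {a : Y → Fin n → ℝ}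
    {w : Y → Fin n → V} (ha : Continuous a) (hinj : ∀ y, Injective (a y)) (hw : Continuous w)
    (L : V →L[ℝ] ℝ) : Continuous fun z : Y × V => shearValue (a z.1) (w z.1) (L z.2) := by
  refine continuous_finsetSum _ fun j _ => Continuous.smul ?_ (by fun_prop)
  exact Continuous.lagrangeValue (a := fun z : Y × V => a z.1) (by fun_prop) (fun z => hinj z.1) j
    (by fun_prop)

/-- A continuous family of shears along the kernel of `L`, with the displacement `w y j` at the
level `a y j` of `L`. -/
noncomputable def shearHomeomorph {Y : Type*} [TopologicalSpace Y] {a : Y → Fin n → ℝ}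
    {w : Y → Fin n → V} (ha : Continuous a) (hinj : ∀ y, Injective (a y)) (hw : Continuous w)
    {L : V →L[ℝ] ℝ} (hL : ∀ y j, L (w y j) = 0) : Y × V ≃ₜ Y × V where
  toFun z := (z.1, z.2 + shearValue (a z.1) (w z.1) (L z.2))
  invFun z := (z.1, z.2 - shearValue (a z.1) (w z.1) (L z.2))
  left_inv z := by simp [map_shearValue_eq_zero _ (hL z.1)]
  right_inv z := by simp [map_shearValue_eq_zero _ (hL z.1)]
  continuous_toFun :=
    continuous_fst.prodMk (continuous_snd.add (continuous_shearValue ha hinj hw L))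
  continuous_invFun :=
    continuous_fst.prodMk (continuous_snd.sub (continuous_shearValue ha hinj hw L))

variable {X : Type*} [TopologicalSpace X]

/-- Near a configuration, one can continuously move all configurations to a fixed one. -/
theorem exists_homeomorph_move_points [FiniteDimensional ℝ V] {e₀ e₁ : V} (he₀ : e₀ ≠ 0)
    {M : V →L[ℝ] ℝ} (hM₀ : M e₀ = 0) (hM₁ : M e₁ = 1) {q : X → Fin n → V} (hq : Continuous q)
    (x : X) (hx : Injective (q x)) :
    ∃ U : Set X, IsOpen U ∧ x ∈ U ∧ ∃ Θ : U × V ≃ₜ U × V, (∀ z, (Θ z).1 = z.1) ∧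
      ∀ u j, Θ (u, q u j) = (u, (j : ℝ) • e₁) := by
  -- One functional separates the points of the configuration at `x`; the extra index `none` makes
  -- it nonzero on `e₀` too, for the division by `L e₀` below.
  obtain ⟨L', hL'⟩ := Module.exists_dual_forall_apply_ne_zero (K := ℝ)
    (fun o : Option {ij : Fin n × Fin n // ij.1 ≠ ij.2} =>
      o.elim e₀ fun ij => q x ij.1.1 - q x ij.1.2) (by
    rintro (_ | ⟨⟨i, j⟩, hij⟩)
    · exact he₀
    · exact sub_ne_zero.2 (hx.ne hij))
  let L : V →L[ℝ] ℝ := LinearMap.toContinuousLinearMap L'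
  have hL₀ : L e₀ ≠ 0 := hL' none
  have hLx : ∀ i j, i ≠ j → L (q x i) - L (q x j) ≠ 0 := fun i j hij => by
    rw [← map_sub]
    exact hL' (some ⟨(i, j), hij⟩)
  let U : Set X := ⋂ i, ⋂ j, ⋂ _ : i ≠ j, {u | L (q u i) - L (q u j) ≠ 0}
  have hU : IsOpen U := isOpen_iInter_of_finite fun i => isOpen_iInter_of_finite fun j =>
    isOpen_iInter_of_finite fun _ => isOpen_ne_fun (by fun_prop) continuous_const
  have hxU : x ∈ U := by
    simp only [U, mem_iInter]
    exact hLx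
  let a : U → Fin n → ℝ := fun u j => L (q u j)
  have ha : Continuous a := by fun_prop
  have hinj : ∀ u, Injective (a u) := by
    intro u i j hij
    by_contra hne
    have := u.2
    simp only [U, mem_iInter] at this
    exact this i j hne (sub_eq_zero.2 hij)
  -- Intermediate positions: the coefficient of `e₀` is chosen so that `L` has the same value as at
  -- `q u j`, while `M` already has its final value `j`.
  let p : U → Fin n → V := fun u j => (j : ℝ) • e₁ + ((a u j - j * L e₁) / L e₀) • e₀
  have hp : Continuous p := by fun_prop
  have hLp : ∀ u j, L (p u j) = a u j := by
    intro u j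
    simp only [p, map_add, map_smul, smul_eq_mul]
    field_simp
    ring
  have hMp : ∀ u j, M (p u j) = j := by
    intro u j
    simp [p, hM₀, hM₁]
  -- The first shear moves `q` to `p` inside the levels of `L`, the second moves `p` to the fixed
  -- configuration inside the levels of `M`.
  let Θ₁ : U × V ≃ₜ U × V := shearHomeomorph (w := fun u j => p u j - q u j) ha hinj (by fun_prop)
    (L := L) fun u j => by rw [map_sub, hLp, sub_self]
  let Θ₂ : U × V ≃ₜ U × V := shearHomeomorph (a := fun _ j => (j : ℝ))
    (w := fun u j => (j : ℝ) • e₁ - p u j) continuous_const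
    (fun _ i j hij => Fin.ext (Nat.cast_injective hij)) (by fun_prop)
    (L := M) fun u j => by simp [hMp, hM₁]
  refine ⟨U, hU, hxU, Θ₁.trans Θ₂, fun _ => rfl, fun u j => ?_⟩
  have h1 : Θ₁ (u, q u j) = (u, p u j) := by
    refine Prod.ext rfl ?_
    change q u j + shearValue (a u) (fun j => p u j - q u j) (a u j) = p u j
    rw [shearValue_apply (hinj u), add_sub_cancel]
  have h2 : Θ₂ (u, p u j) = (u, (j : ℝ) • e₁) := by
    refine Prod.ext rfl ?_
    change p u j + shearValue (fun i : Fin n => (i : ℝ)) (fun j => (j : ℝ) • e₁ - p u j)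
      (M (p u j)) = (j : ℝ) • e₁
    rw [hMp, shearValue_apply (a := fun i : Fin n => (i : ℝ))
      (fun i j hij => Fin.ext (Nat.cast_injective hij)), add_sub_cancel]
  rw [Homeomorph.trans_apply, h1, h2]

/-- The space of pairs of a point `x` and a point `z` different from all the `q x j`. -/
abbrev PuncturedSpace (q : X → Fin n → V) : Type _ := {y : X × V // ∀ j, y.2 ≠ q y.1 j}

/-- The family of complements of configurations of `n` points in a real vector space of dimension
at least two is locally trivial. -/
theorem isFiberBundleWithFiber_puncturedSpace [FiniteDimensional ℝ V] {e₀ e₁ : V} (he₀ : e₀ ≠ 0)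
    {M : V →L[ℝ] ℝ} (hM₀ : M e₀ = 0) (hM₁ : M e₁ = 1) {q : X → Fin n → V} (hq : Continuous q)
    (hinj : ∀ x, Injective (q x)) :
    IsFiberBundleWithFiber (↥(range fun j : Fin n => (j : ℝ) • e₁)ᶜ)
      (fun y : PuncturedSpace q => y.1.1) := by
  intro x
  obtain ⟨U, hU, hxU, Θ, hΘ, hΘq⟩ := exists_homeomorph_move_points he₀ hM₀ hM₁ hq x (hinj x)
  have : Nonempty ↥(range fun j : Fin n => (j : ℝ) • e₁)ᶜ := by
    refine ⟨e₀, ?_⟩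
    rintro ⟨j, hj⟩
    have : (j : ℝ) = 0 := by simpa [hM₀, hM₁] using congrArg M hj
    simp only [this, zero_smul] at hj
    exact he₀ hj.symm
  have hΘs : ∀ z, (Θ.symm z).1 = z.1 := fun z => by
    conv_rhs => rw [← Θ.apply_symm_apply z, hΘ]
  let p : PuncturedSpace q → X := fun y => y.1.1
  let lift : p ⁻¹' U → U × V := fun y => (⟨y.1.1.1, y.2⟩, y.1.1.2)
  have hlift : Continuous lift := by fun_prop
  have hfwd : ∀ y, (Θ (lift y)).2 ∈ (range fun j : Fin n => (j : ℝ) • e₁)ᶜ := by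
    rintro y ⟨j, hj⟩
    have h1 : Θ (lift y) = Θ ((lift y).1, q y.1.1.1 j) := by
      rw [hΘq (lift y).1 j]
      exact Prod.ext (hΘ _) hj.symm
    exact y.1.2 j (congrArg Prod.snd (Θ.injective h1))
  have hinv : ∀ (z : U × ↥(range fun j : Fin n => (j : ℝ) • e₁)ᶜ) (j : Fin n),
      (Θ.symm (z.1, (z.2 : V))).2 ≠ q z.1 j := by
    intro z j hj
    refine z.2.2 ⟨j, ?_⟩
    have h1 : Θ.symm (z.1, (z.2 : V)) = (z.1, q z.1 j) := Prod.ext (hΘs _) hj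
    rw [Homeomorph.symm_apply_eq, hΘq] at h1
    exact (congrArg Prod.snd h1).symm
  let H : p ⁻¹' U ≃ₜ U × ↥(range fun j : Fin n => (j : ℝ) • e₁)ᶜ :=
    { toFun := fun y => ((lift y).1, ⟨(Θ (lift y)).2, hfwd y⟩)
      invFun := fun z => ⟨⟨(z.1, (Θ.symm (z.1, (z.2 : V))).2), hinv z⟩, z.1.2⟩
      left_inv := fun y => by
        refine Subtype.ext (Subtype.ext (Prod.ext rfl ?_))
        change (Θ.symm ((lift y).1, (Θ (lift y)).2)).2 = (lift y).2
        have h1 : ((lift y).1, (Θ (lift y)).2) = Θ (lift y) := Prod.ext (hΘ (lift y)).symm rfl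
        rw [h1, Homeomorph.symm_apply_apply]
      right_inv := fun z => by
        refine Prod.ext rfl (Subtype.ext ?_)
        change (Θ (z.1, (Θ.symm (z.1, (z.2 : V))).2)).2 = z.2
        have h1 : (z.1, (Θ.symm (z.1, (z.2 : V))).2) = Θ.symm (z.1, (z.2 : V)) :=
          Prod.ext (hΘs (z.1, (z.2 : V))).symm rfl
        rw [h1, Homeomorph.apply_symm_apply]
      continuous_toFun :=
        (continuous_fst.comp hlift).prodMk
          ((continuous_snd.comp (Θ.continuous.comp hlift)).subtype_mk _)
      continuous_invFun := by
        have h1 : Continuous fun z : U × ↥(range fun j : Fin n => (j : ℝ) • e₁)ᶜ =>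
            (Θ.symm (z.1, (z.2 : V))).2 :=
          continuous_snd.comp (Θ.symm.continuous.comp (by fun_prop))
        exact (((continuous_subtype_val.comp continuous_fst).prodMk h1).subtype_mk _).subtype_mk _ }
  exact exists_trivialization_of_homeomorph (p := p) (by fun_prop) hU hxU H fun _ => rfl

end LocalTriviality

/-! ### Roots, total spaces and pullbacks. -/

section RootMaps

variable {ℓ n : ℕ} {c : FiberCoordinates ℓ} {A : HyperplaneArrangement (ℓ + 1)}
  {B : HyperplaneArrangement ℓ} {g : Fin n → ((Fin ℓ → ℂ) →ᵃ[ℂ] ℂ)}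

theorem continuous_fiberCoordinates (c : FiberCoordinates ℓ) : Continuous c :=
  c.toAffineMap.continuous_of_finiteDimensional

theorem continuous_fiberCoordinates_symm (c : FiberCoordinates ℓ) : Continuous c.symm :=
  c.symm.toAffineMap.continuous_of_finiteDimensional

/-- The fiber coordinates of `k` points of the total space. -/
noncomputable def fiberCoordPow (c : FiberCoordinates ℓ) (k : ℕ)
    (y : Fin k → Fin (ℓ + 1) → ℂ) : Fin k → ℂ :=
  fun i => (c (y i)).2

namespace IsRootMap

theorem mem_M_iff (hg : IsRootMap c A B g) {y : Fin (ℓ + 1) → ℂ} :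
    y ∈ A.M ↔ coordProj c y ∈ B.M ∧ ∀ j, (c y).2 ≠ g j (c y).1 := by
  rw [A.mem_M, B.mem_M, hg.hyperplanes_eq]
  constructor
  · exact fun h => ⟨fun H hH => h _ (Or.inl ⟨H, hH, rfl⟩), fun j => h _ (Or.inr ⟨j, rfl⟩)⟩
  · rintro ⟨h1, h2⟩ _ (⟨H, hH, rfl⟩ | ⟨j, rfl⟩)
    · exact h1 H hH
    · exact h2 j

/-- Avoiding the `k`-th power of a graph hyperplane requires only one of the `k` points to lie off
the graph, which says that two vectors of `ℂ^k` differ. -/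
theorem mem_MPow_iff (hg : IsRootMap c A B g) {k : ℕ} {y : Fin k → Fin (ℓ + 1) → ℂ} :
    y ∈ A.MPow k ↔ coordProjPow c k y ∈ B.MPow k ∧
      ∀ j, fiberCoordPow c k y ≠ rootMapPow g k (coordProjPow c k y) j := by
  rw [A.mem_MPow, B.mem_MPow, hg.hyperplanes_eq]
  constructor
  · intro h
    refine ⟨fun H hH => h _ (Or.inl ⟨H, hH, rfl⟩), fun j hj => ?_⟩
    obtain ⟨i, hi⟩ := h _ (Or.inr ⟨j, rfl⟩)
    exact hi (congrFun hj i)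
  · rintro ⟨h1, h2⟩ _ (⟨H, hH, rfl⟩ | ⟨j, rfl⟩)
    · exact h1 H hH
    · exact Function.ne_iff.1 (h2 j)

/-- The fiber of `M(A)` over a point `x` of `M(B)` is the complement of the roots at `x`. -/
noncomputable def fiberHomeomorph (hg : IsRootMap c A B g) (hp : MapsTo (coordProj c) A.M B.M)
    (x : B.M) :
    hp.restrict (coordProj c) A.M B.M ⁻¹' {x} ≃ₜ ↥(range fun j => g j (x : Fin ℓ → ℂ))ᶜ where
  toFun y := ⟨(c y.1.1).2, by
    rintro ⟨j, hj⟩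
    have h1 : (c y.1.1).1 = x := congrArg Subtype.val y.2
    exact (hg.mem_M_iff.1 y.1.2).2 j (by rw [h1]; exact hj.symm)⟩
  invFun z := ⟨⟨c.symm (x, z), hg.mem_M_iff.2 ⟨by simp [coordProj], fun j hj =>
    z.2 ⟨j, by simpa using hj.symm⟩⟩⟩, Subtype.ext (by simp [coordProj])⟩
  left_inv y := by
    have h1 : (c y.1.1).1 = x := congrArg Subtype.val y.2
    refine Subtype.ext (Subtype.ext ?_)
    change c.symm (x, (c y.1.1).2) = y.1.1
    rw [← h1]
    exact c.symm_apply_apply _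
  right_inv z := Subtype.ext (by simp)
  continuous_toFun := by
    have := continuous_fiberCoordinates c
    fun_prop
  continuous_invFun := by
    have := continuous_fiberCoordinates_symm c
    fun_prop

/-- The roots at a point of `M(B)` are distinct. -/
theorem injective_apply (hAB : IsStrictlyLinearlyFibered c A B) (hg : IsRootMap c A B g)
    {x : Fin ℓ → ℂ} (hx : x ∈ B.M) : Injective fun j => g j x := by
  classical
  obtain ⟨-, hp, S, hS, hb⟩ := hAB
  -- Every fiber is homeomorphic to the same `Sᶜ`, so the number of distinct roots is constant on
  -- `M(B)`, without any appeal to connectedness.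
  have hcard : ∀ x ∈ B.M, (range fun j => g j x).ncard = S.ncard := by
    intro x hx
    obtain ⟨e, he⟩ := hb ⟨x, hx⟩
    exact ncard_eq_ncard_of_homeomorph_compl (finite_range _) hS
      ((hg.fiberHomeomorph hp ⟨x, hx⟩).symm.trans (e.preimageSingletonHomeomorph he))
  -- The differences of the `g j` are not identically zero, so at some point of `M(B)` all `n` roots
  -- differ; the constant is therefore `n`.
  obtain ⟨x₀, hx₀, hne⟩ := B.exists_mem_M_forall_ne_zero
    ((Finset.univ.filter fun ij : Fin n × Fin n => ij.1 ≠ ij.2).image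
      fun ij => g ij.1 - g ij.2) (by
    intro f hf
    obtain ⟨⟨i, j⟩, hij, rfl⟩ := Finset.mem_image.1 hf
    rw [Finset.mem_filter] at hij
    by_contra! h
    exact hij.2 (hg.injective (AffineMap.ext fun x => sub_eq_zero.1 (h x))))
  have hinj₀ : Injective fun j => g j x₀ := by
    intro i j hij
    by_contra h
    refine hne (g i - g j) (Finset.mem_image.2 ⟨(i, j), by simpa using h, rfl⟩) ?_
    exact sub_eq_zero.2 hij
  have h1 : (range fun j => g j x₀).ncard = n := by
    rw [← image_univ, ncard_image_of_injective _ hinj₀, ncard_univ, Nat.card_fin]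
  have h2 : (range fun j => g j x).ncard = n := by rw [hcard x hx, ← hcard x₀ hx₀, h1]
  rw [← image_univ] at h2
  have h3 := injOn_of_ncard_image_eq (s := univ) (f := fun j => g j x)
    (by rw [h2, ncard_univ, Nat.card_fin])
  exact injOn_univ.1 h3

/-- The root map takes `M(B^k)` to the configuration space. -/
theorem injective_rootMapPow (hAB : IsStrictlyLinearlyFibered c A B) (hg : IsRootMap c A B g)
    {k : ℕ} (hk : 1 ≤ k) {x : Fin k → Fin ℓ → ℂ} (hx : x ∈ B.MPow k) :
    Injective (rootMapPow g k x) := by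
  intro i j hij
  by_contra hne
  have h0 : ∀ m, (g i - g j) (x m) = 0 := fun m => sub_eq_zero.2 (congrFun hij m)
  -- This zero set is nonempty and, as the roots are distinct over `M(B)`, misses `M(B)`. All
  -- components of `x` lie in it, which `x ∈ M(B^k)` forbids for a hyperplane of `B`.
  have hmem : {y | (g i - g j) y = 0} ∈ B.hyperplanes := by
    refine B.mem_of_disjoint ⟨g i - g j, ?_, rfl⟩ ⟨x ⟨0, hk⟩, h0 _⟩ ?_
    · by_contra! h
      exact hne (hg.injective (AffineMap.ext fun y => sub_eq_zero.1 (h y)))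
    · intro y hy hyB
      exact hne (hg.injective_apply hAB hyB (sub_eq_zero.1 hy))
  obtain ⟨m, hm⟩ := B.mem_MPow.1 hx _ hmem
  exact hm (h0 m)

theorem continuous_rootMapPow (g : Fin n → ((Fin ℓ → ℂ) →ᵃ[ℂ] ℂ)) (k : ℕ) :
    Continuous (rootMapPow g k) := by
  refine continuous_pi fun j => continuous_pi fun i => ?_
  exact (g j).continuous_of_finiteDimensional.comp (continuous_apply i)

/-- `M(A^k)` is the space of pairs of a point `x` of `M(B^k)` and a point of `ℂ^k` different from
the values at `x` of the root map. -/
noncomputable def totalSpaceHomeomorph (hg : IsRootMap c A B g) (k : ℕ) :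
    A.MPow k ≃ₜ PuncturedSpace fun x : B.MPow k => rootMapPow g k (x : Fin k → Fin ℓ → ℂ) where
  toFun y := ⟨(⟨coordProjPow c k y, (hg.mem_MPow_iff.1 y.2).1⟩, fiberCoordPow c k y),
    (hg.mem_MPow_iff.1 y.2).2⟩
  invFun z := ⟨fun i => c.symm (z.1.1.1 i, z.1.2 i), hg.mem_MPow_iff.2 (by
    have h1 : coordProjPow c k (fun i => c.symm (z.1.1.1 i, z.1.2 i)) = z.1.1.1 := by
      funext i; simp [coordProjPow, coordProj]
    have h2 : fiberCoordPow c k (fun i => c.symm (z.1.1.1 i, z.1.2 i)) = z.1.2 := by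
      funext i; simp [fiberCoordPow]
    rw [h1, h2]
    exact ⟨z.1.1.2, z.2⟩)⟩
  left_inv y := by
    refine Subtype.ext (funext fun i => ?_)
    exact c.symm_apply_apply (y.1 i)
  right_inv z := by
    refine Subtype.ext (Prod.ext (Subtype.ext (funext fun i => ?_)) (funext fun i => ?_))
    · simp [coordProjPow, coordProj]
    · simp [fiberCoordPow]
  continuous_toFun := by
    have h1 : ∀ i, Continuous fun y : A.MPow k => c (y.1 i) := fun i =>
      (continuous_fiberCoordinates c).comp ((continuous_apply i).comp continuous_subtype_val)
    exact (((continuous_pi fun i => (h1 i).fst).subtype_mk _).prodMk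
      (continuous_pi fun i => (h1 i).snd)).subtype_mk _
  continuous_invFun := by
    refine Continuous.subtype_mk (continuous_pi fun i => ?_) _
    refine (continuous_fiberCoordinates_symm c).comp (Continuous.prodMk ?_ ?_)
    · exact (continuous_apply i).comp
        (continuous_subtype_val.comp (continuous_fst.comp continuous_subtype_val))
    · exact (continuous_apply i).comp (continuous_snd.comp continuous_subtype_val)

end IsRootMap

/-- The pullback of the configuration space bundle is the space of pairs of a point `x` and a point
different from the points of the configuration at `x`. -/
noncomputable def pullbackConfigurationHomeomorph {X : Type*} [TopologicalSpace X] {k : ℕ}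
    {q : X → configurationSpace k n} (hq : Continuous q) :
    PuncturedSpace (fun x => (q x : Fin n → Fin k → ℂ)) ≃ₜ
      q.Pullback (configurationProj k n) where
  -- The pullback condition prescribes the first `n` points, so only the last point is free.
  toFun y := ⟨(y.1.1, ⟨Fin.snoc (α := fun _ => Fin k → ℂ) (q y.1.1).1 y.1.2,
      (Fin.snoc_injective_iff).2 ⟨(q y.1.1).2, fun ⟨j, hj⟩ => y.2 j hj.symm⟩⟩),
    Subtype.ext (funext fun j => by simp [configurationProj])⟩
  invFun z := ⟨(z.1.1, z.1.2.1 (Fin.last n)), fun j hj => by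
    have h1 : (q z.1.1).1 j = z.1.2.1 j.castSucc := congrFun (congrArg Subtype.val z.2) j
    replace hj := hj.trans h1
    exact (Fin.castSucc_lt_last j).ne' (z.1.2.2 hj)⟩
  left_inv y := Subtype.ext (Prod.ext rfl (by simp))
  right_inv z := by
    refine Subtype.ext (Prod.ext rfl (Subtype.ext (funext fun j => ?_)))
    refine Fin.lastCases ?_ (fun j => ?_) j
    · simp
    · have h1 : (q z.1.1).1 j = z.1.2.1 j.castSucc := congrFun (congrArg Subtype.val z.2) j
      simp [h1]
  continuous_toFun := by
    refine ((continuous_fst.comp continuous_subtype_val).prodMk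
      (Continuous.subtype_mk (continuous_pi fun j => ?_) _)).subtype_mk _
    refine Fin.lastCases ?_ (fun j => ?_) j
    · simp only [Fin.snoc_last]
      fun_prop
    · simp only [Fin.snoc_castSucc]
      exact (continuous_apply j).comp (continuous_subtype_val.comp
        (hq.comp (continuous_fst.comp continuous_subtype_val)))
  continuous_invFun := by
    refine Continuous.subtype_mk (Continuous.prodMk ?_ ?_) _
    · exact continuous_fst.comp continuous_subtype_val
    · exact (continuous_apply (Fin.last n)).comp (continuous_subtype_val.comp
        (continuous_snd.comp continuous_subtype_val))

end RootMaps

/-! ### The theorem. -/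

theorem mainTheorem6 {ℓ : ℕ} (c : FiberCoordinates ℓ) (A : HyperplaneArrangement (ℓ + 1))
    (B : HyperplaneArrangement ℓ) (hAB : IsStrictlyLinearlyFibered c A B) :
    ∃ n : ℕ, A.hyperplanes.ncard = B.hyperplanes.ncard + n ∧
      (∃ g : Fin n → ((Fin ℓ → ℂ) →ᵃ[ℂ] ℂ), IsRootMap c A B g) ∧
      ∀ k : ℕ, 1 ≤ k →
        ∃ hp : MapsTo (coordProjPow c k) (A.MPow k) (B.MPow k),
          (∃ S : Set (Fin k → ℂ), S.encard = n ∧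
            IsFiberBundleWithFiber (↥Sᶜ)
              (hp.restrict (coordProjPow c k) (A.MPow k) (B.MPow k))) ∧
          (∀ g : Fin n → ((Fin ℓ → ℂ) →ᵃ[ℂ] ℂ), IsRootMap c A B g →
            ∃ hg : MapsTo (rootMapPow g k) (B.MPow k) (configurationSpace k n),
              BundleEquivalent
                (hp.restrict (coordProjPow c k) (A.MPow k) (B.MPow k))
                (Function.Pullback.fst :
                  (hg.restrict (rootMapPow g k) (B.MPow k) (configurationSpace k n)).Pullback
                    (configurationProj k n) → B.MPow k)) ∧
          ∃ s : B.MPow k → A.MPow k, Continuous s ∧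
            ∀ x, hp.restrict (coordProjPow c k) (A.MPow k) (B.MPow k) (s x) = x := by
  obtain ⟨n, hn, g, hg⟩ := exists_isRootMap hAB.1
  refine ⟨n, hn, ⟨g, hg⟩, fun k hk => ⟨fun y hy => (hg.mem_MPow_iff.1 hy).1, ?_, ?_, ?_⟩⟩
  -- The real directions `1` and `i` in the first coordinate, with `M` its imaginary part; the model
  -- fiber omits the points with first coordinate `0, i, …, (n-1)i` and all others zero.
  · let i₀ : Fin k := ⟨0, hk⟩
    let e₀ : Fin k → ℂ := Pi.single i₀ 1
    let e₁ : Fin k → ℂ := Pi.single i₀ Complex.I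
    let M : (Fin k → ℂ) →L[ℝ] ℝ := Complex.imCLM.comp (ContinuousLinearMap.proj i₀)
    have hM₀ : M e₀ = 0 := by simp [M, e₀]
    have hM₁ : M e₁ = 1 := by simp [M, e₁]
    have he₀ : e₀ ≠ 0 := by simp [e₀]
    refine ⟨range fun j : Fin n => (j : ℝ) • e₁, ?_, ?_⟩
    · have hinj : Injective fun j : Fin n => (j : ℝ) • e₁ := fun i j hij => by
        have := congrArg M hij
        simp only [map_smul, hM₁, smul_eq_mul, mul_one] at this
        exact Fin.ext (Nat.cast_injective this)
      rw [← image_univ, hinj.encard_image, encard_univ]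
      simp
    · exact (isFiberBundleWithFiber_puncturedSpace he₀ hM₀ hM₁
        ((IsRootMap.continuous_rootMapPow g k).comp continuous_subtype_val)
        fun x => hg.injective_rootMapPow hAB hk x.2).comp_homeomorph (hg.totalSpaceHomeomorph k)
  · intro g' hg'
    have hmaps : MapsTo (rootMapPow g' k) (B.MPow k) (configurationSpace k n) :=
      fun x hx => hg'.injective_rootMapPow hAB hk hx
    exact ⟨hmaps, (hg'.totalSpaceHomeomorph k).trans (pullbackConfigurationHomeomorph
      ((IsRootMap.continuous_rootMapPow g' k).restrict hmaps)), fun _ => rfl⟩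
  -- Each coordinate of the section exceeds the sum of the norms of the omitted points, hence the
  -- norm of each of them.
  · let s : B.MPow k → PuncturedSpace fun x : B.MPow k => rootMapPow g k (x : Fin k → Fin ℓ → ℂ) :=
      fun x => ⟨(x, fun _ => ((1 + ∑ j, ‖rootMapPow g k (x : Fin k → Fin ℓ → ℂ) j‖ : ℝ) : ℂ)),
        fun j hj => by
          have h1 := norm_le_pi_norm (rootMapPow g k (x : Fin k → Fin ℓ → ℂ) j) ⟨0, hk⟩
          have h2 := Finset.single_le_sum
            (f := fun j => ‖rootMapPow g k (x : Fin k → Fin ℓ → ℂ) j‖)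
            (fun j _ => norm_nonneg _) (Finset.mem_univ j)
          have h4 := congrFun hj ⟨0, hk⟩
          dsimp only at h4
          rw [← h4, Complex.norm_real] at h1
          have h3 := (le_abs_self _).trans h1
          linarith⟩
    have hs : Continuous s := by
      have := IsRootMap.continuous_rootMapPow g k
      fun_prop
    refine ⟨fun x => (hg.totalSpaceHomeomorph k).symm (s x),
      (hg.totalSpaceHomeomorph k).symm.continuous.comp hs, fun x => ?_⟩
    exact congrArg (fun z => z.1.1) ((hg.totalSpaceHomeomorph k).apply_symm_apply (s x))
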